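/- **Conventions.** A *machine* is a partial recursive function taking a binary program $p$ and a condition $y\in\mathbb N$ to a binary string. A machine $U$ is *universal* if for every machine $V$ there is a constant $c_V$ such that every program $p$ has a program $q$ with $|q|\le |p|+c_V$ and $U(q,y)=V(p,y)$ for all $y$. Fix such a $U$ and let $C(x\mid y)=\min\{|p| : U(p,y)=x\}$. A graph $G$ on the nodes $\{1,\dots,n\}$ is coded by the string $E(G)$ of $n(n-1)/2$ bits that records, in lexicographical order of the pairs $u<v$, which pairs are edges. For $\delta:\mathbb N\to\mathbb R$, $G$ is *$\delta(n)$-random* if $$C(E(G)\mid n,\delta(n))\ \ge\ \tfrac{n(n-1)}2-\delta(n),$$ where $\delta(n)$ is given in the condition through its integer part (taken as $0$ if $\delta(n)<0$). A *routing scheme* for $G$ assigns distinct labels to the nodes, labels the edges at each node $u$ by distinct numbers, and stores a binary string $F(u)$ at each node $u$. A fixed computable function (the *decoder*) determines from $F(u)$, the label of $u$, the increasing list of the labels of the edges at $u$, and the label of a destination $v\ne u$, the label of the edge over which $u$ forwards a message for $v$. It is a *shortest path* routing scheme if for all $u,v$ a message forwarded in this way from $u$ with destination $v$ arrives at $v$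 after exactly $d_G(u,v)$ steps (in particular $G$ is connected). Edge labels follow one of two models: (IB) the edges at $u$ are labeled by ports $1,\dots,\deg u$, by a port assignment that may be chosen together with the scheme; (II) the edge at $u$ leading to $w$ carries the label of $w$. Node labels follow one of three models: ($\alpha$) node $i$ has label $i$; ($\beta$) the labels are a permutation of $1,\dots,n$ that may be chosen; ($\gamma$) the labels are arbitrary distinct natural numbers. The *cost* of $u$ is $|F(u)|$, to which in model $\gamma$ the number of bits of the label of $u$ is added. **Theorem.** For each of the six models (IB or II, combined with $\alpha$, $\beta$ or $\gamma$) there is a computable decoder, depending on the model only, such that for every universal $U$ and every $\delta$ with $\delta(n)=O(\log n)$ the following holds for all sufficiently large $n$: every $\delta(n)$-random labeled graph $G$ on $n$ nodes has a shortest path routing scheme, conforming to the model, in which every node has cost at most $3n$ bits. Hence the total cost of the scheme is at most $3n^2$ bits. -/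

import Mathlib

namespace CompactRouting

/-! ### Conditional Kolmogorov complexity -/

/-- A machine: a partial function taking a binary program and a condition (a natural number) to a
binary string.  Turing machines compute exactly those satisfying `Partrec`. -/
abbrev Machine := List Bool × ℕ →. List Bool

/-- `U` is an (appropriate) universal machine: it is partial recursive, and for every partial
recursive machine `V` it has, for each program `p`, a program `⟨V, p⟩` with
`U (⟨V, p⟩, y) = V (p, y)` for all `y`, which is longer than `p` by at most a constant
depending only on `V`. -/
def IsUniversal (U : Machine) : Prop :=
  Partrec U ∧ ∀ V : Machine, Partrec V →
    ∃ (c : ℕ) (tr : List Bool → List Bool), ∀ p : List Bool,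
      (tr p).length ≤ p.length + c ∧ ∀ y : ℕ, U (tr p, y) = V (p, y)

/-- Kolmogorov complexity `C(x | y)` with respect to `U`: the length of a shortest program with
which `U` produces `x` given `y`.  (For universal `U` such a program always exists.) -/
noncomputable def complexity (U : Machine) (x : List Bool) (y : ℕ) : ℕ :=
  sInf {k | ∃ p : List Bool, p.length = k ∧ x ∈ U (p, y)}

/-- A concrete universal machine: on the program `1ⁱ 0 p` it runs the `i`-th code on `(p, y)`. -/
def stdMachine : Machine := fun a =>
  (Nat.Partrec.Code.eval
      (Denumerable.ofNat Nat.Partrec.Code (a.1.takeWhile id).length)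
      (Encodable.encode ((a.1.dropWhile id).tail, a.2))).bind
    fun m => ((Encodable.decode m : Option (List Bool)) : Part (List Bool))

theorem stdMachine_isUniversal : IsUniversal stdMachine := by
  refine ⟨?_, fun V hV => ?_⟩
  · have h1 : Computable fun a : List Bool × ℕ =>
        Denumerable.ofNat Nat.Partrec.Code (a.1.takeWhile id).length :=
      (Computable.ofNat _).comp ((Primrec.list_length.comp
        ((Primrec.list_takeWhile Primrec.id).comp Primrec.fst)).to_comp)
    have h2 : Computable fun a : List Bool × ℕ =>
        Encodable.encode ((a.1.dropWhile id).tail, a.2) :=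
      (Primrec.encode.comp (Primrec.pair (Primrec.list_tail.comp
        ((Primrec.list_dropWhile Primrec.id).comp Primrec.fst)) Primrec.snd)).to_comp
    refine (Nat.Partrec.Code.eval_part.comp h1 h2).bind ?_
    exact (Computable.ofOption (Computable.decode.comp Computable.snd)).to₂
  · obtain ⟨c, hc⟩ := Nat.Partrec.Code.exists_code.1 hV
    refine ⟨Encodable.encode c + 1,
      fun p => List.replicate (Encodable.encode c) true ++ false :: p, fun p => ⟨?_, fun y => ?_⟩⟩
    · simp only [List.length_append, List.length_replicate, List.length_cons]
      omega
    · have e1 : ((List.replicate (Encodable.encode c) true ++ false :: p).takeWhile id)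
          = List.replicate (Encodable.encode c) true := by
        rw [List.takeWhile_append_of_pos (by simp)]; simp
      have e2 : ((List.replicate (Encodable.encode c) true ++ false :: p).dropWhile id)
          = false :: p := by
        rw [List.dropWhile_append_of_pos (by simp)]; simp
      simp only [stdMachine, e1, e2, List.length_replicate, Denumerable.ofNat_encode, hc,
        List.tail_cons, Encodable.encodek, Part.coe_some, Part.bind_some]
      rw [Part.bind_map]
      simp [Encodable.encodek]

/-! ### Random graphs

The nodes `1, …, n` are represented by `Fin n`, the node `u : Fin n` being number `u + 1`. -/

open Classical in
/-- The code `E(G)`: the `n (n - 1) / 2` possible edges `{u, v}`, `u < v`, are listed in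
lexicographical order, and each contributes the bit telling whether it is present. -/
noncomputable def graphCode {n : ℕ} (G : SimpleGraph (Fin n)) : List Bool :=
  ((List.finRange n ×ˢ List.finRange n).filter fun e => e.1 < e.2).map
    fun e => decide (G.Adj e.1 e.2)

/-- `G` is `δ(n)`-random: `C(E(G) | n, δ) ≥ n (n - 1) / 2 - δ(n)`.  Since `C` is integer valued,
only the integer part of `δ(n)` matters, and this is what is given in the condition; the family of
all labeled graphs on `n` nodes is determined by `n`. -/
def IsRandomGraph (U : Machine) (δ : ℕ → ℝ) {n : ℕ} (G : SimpleGraph (Fin n)) : Prop :=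
  (n : ℝ) * ((n : ℝ) - 1) / 2 - δ n ≤
    (complexity U (graphCode G) (Nat.pair n ⌊δ n⌋₊) : ℝ)

/-! ### Routing schemes -/

/-- What a node knows about its incident edges. -/
inductive EdgeModel
  /-- IB: edges are attached to ports `1, …, deg`, by a port assignment that may be chosen. -/
  | freePorts
  /-- II: an edge carries the label of the node it leads to. -/
  | neighboursKnown

/-- How nodes may be relabeled. -/
inductive LabelModel
  /-- α: no relabeling. -/
  | fixed
  /-- β: relabeling within `1, …, n`. -/
  | permuted
  /-- γ: arbitrary relabeling, label bits being charged. -/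
  | free

/-- A fixed way of interpreting stored bits as a local routing function.  From the bits stored at
a node, the label of the node, the increasing list of the labels of its incident edges, and the
label of a destination, it determines the label of the edge over which to route. -/
abbrev Decoder := List Bool × ℕ × List ℕ × ℕ → ℕ

/-- A routing scheme on `G`: node labels, labels of the edges at each node (`edgeLabel u w` is the
label at `u` of the edge from `u` to `w`, relevant only for adjacent `u`, `w`), and the bits
stored at each node to represent its local routing function. -/
structure RoutingScheme {n : ℕ} (G : SimpleGraph (Fin n)) where
  label : Fin n → ℕ
  label_injective : Function.Injective label
  edgeLabel : Fin n → Fin n → ℕ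
  edgeLabel_injOn : ∀ u, Set.InjOn (edgeLabel u) (G.neighborSet u)
  bits : Fin n → List Bool

namespace RoutingScheme

variable {n : ℕ} {G : SimpleGraph (Fin n)}

/-- The edge labels conform to the model. -/
def EdgesConform (S : RoutingScheme G) : EdgeModel → Prop
  | .freePorts => ∀ u, Set.BijOn (S.edgeLabel u) (G.neighborSet u)
      (Set.Icc 1 (G.neighborSet u).ncard)
  | .neighboursKnown => ∀ u w, G.Adj u w → S.edgeLabel u w = S.label w

/-- The node labels conform to the model. -/
def LabelsConform (S : RoutingScheme G) : LabelModel → Prop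
  | .fixed => ∀ u, S.label u = (u : ℕ) + 1
  | .permuted => ∀ u, S.label u ∈ Set.Icc 1 n
  | .free => True

open Classical in
/-- The labels of the edges incident to `u`, in increasing order. -/
noncomputable def incidentLabels (S : RoutingScheme G) (u : Fin n) : List ℕ :=
  ((Finset.univ.filter fun w => G.Adj u w).image (S.edgeLabel u)).sort (· ≤ ·)

/-- The local routing function of `u` applied to the destination `v`. -/
noncomputable def route (S : RoutingScheme G) (D : Decoder) (u v : Fin n) : ℕ :=
  D (S.bits u, S.label u, S.incidentLabels u, S.label v)

/-- `S.Delivers D k u v`: a message at `u` with destination `v`, forwarded by the local routing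
functions, arrives at `v` after traversing exactly `k` edges. -/
inductive Delivers (S : RoutingScheme G) (D : Decoder) : ℕ → Fin n → Fin n → Prop
  | arrived (v : Fin n) : Delivers S D 0 v v
  | hop {k : ℕ} {u v w : Fin n} (hne : u ≠ v) (hadj : G.Adj u w)
      (hroute : S.route D u v = S.edgeLabel u w) (hrest : Delivers S D k w v) :
      Delivers S D (k + 1) u v

/-- Every pair of nodes is connected by a route, and every route is a shortest path.
(`Delivers` forces `u` and `v` to be connected, so `dist` has no junk value here.) -/
def IsShortestPath (S : RoutingScheme G) (D : Decoder) : Prop :=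
  ∀ u v, S.Delivers D (G.dist u v) u v

/-- The number of bits charged to the node `u`. -/
def nodeCost (S : RoutingScheme G) : LabelModel → Fin n → ℕ
  | .free, u => (S.bits u).length + Nat.size (S.label u)
  | _, u => (S.bits u).length

end RoutingScheme

end CompactRouting

namespace CompactRouting

/-! ### Enumerations and complexity -/

/-! A node `u` stores for each destination `v` a number in unary: 0 if `v` is a neighbour, otherwise
one more than the position, among the neighbours of `u` in increasing order, of the first one
adjacent to `v`. If any two nodes have a common neighbour, the diameter is at most 2 and these
numbers give shortest paths. In a uniformly random graph `v` is a neighbour with probability 1/2,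
and otherwise the waiting time for a suitable neighbour is essentially geometric with mean at most
2. The expected table length is thus about `2 * n` bits; the threshold `11 * n / 4` lies above this
and leaves `n / 4` of the allowed `3 * n` bits for a label in model γ.

Two exponential estimates make failures rare. `average_pow_hopIndex_le` bounds the moment with base
4/3 of the sum of the stored numbers by `(3 / 2) ^ n`, and Markov's inequality shows that long
tables are rare. `average_noCommonNeighbour_le` bounds by `(3 / 4) ^ (n - 2)` the probability that
two given nodes have no common neighbour. So at most a fraction `2 ^ (-(n / 16))` of all graphs is
atypical, for large `n`.

Atypicality is primitive recursive in the graph code, so by `IsUniversal.exists_complexity_le` an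
atypical graph is described by its index in the list of atypical codes. This saves `n / 16 - O(1)`
bits, more than a deficiency of order `log n` permits, so random graphs are typical.

The decoder selects an edge by its rank in the sorted list of edge labels. Since all labels are
chosen increasing in the neighbour, one scheme and one decoder serve all six models. -/

theorem primrec_idxOf {α : Type*} [Primcodable α] [BEq α] [LawfulBEq α] :
    Primrec₂ (List.idxOf : α → List α → ℕ) := by
  classical
  refine (Primrec.list_idxOf (α := α)).of_eq fun a l => ?_
  simp only [List.idxOf]
  congr 1
  funext x
  rw [Bool.eq_iff_iff]
  simp

theorem primrecRel_exists_lt {α : Type*} [Primcodable α] {R : ℕ → α → Prop} (h : PrimrecRel R) :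
    PrimrecRel fun n y => ∃ x < n, R x y :=
  (h.exists_mem_list.comp (Primrec.list_range.comp Primrec.fst) Primrec.snd).of_eq (by simp)

theorem primrecRel_forall_lt {α : Type*} [Primcodable α] {R : ℕ → α → Prop} (h : PrimrecRel R) :
    PrimrecRel fun n y => ∀ x < n, R x y :=
  (h.forall_mem_list.comp (Primrec.list_range.comp Primrec.fst) Primrec.snd).of_eq (by simp)

/-- All binary strings of a given length. -/
def bitStrings : ℕ → List (List Bool)
  | 0 => [[]]
  | k + 1 => (bitStrings k).map (List.cons false) ++ (bitStrings k).map (List.cons true)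

theorem mem_bitStrings {k : ℕ} {l : List Bool} : l ∈ bitStrings k ↔ l.length = k := by
  induction k generalizing l with
  | zero => simp [bitStrings]
  | succ k ih =>
    rcases l with _ | ⟨b, l⟩
    · simp [bitStrings]
    · cases b <;> simp [bitStrings, ih]

theorem nodup_bitStrings (k : ℕ) : (bitStrings k).Nodup := by
  induction k with
  | zero => simp [bitStrings]
  | succ k ih =>
    refine List.Nodup.append (ih.map List.cons_injective) (ih.map List.cons_injective) ?_
    intro l h1 h2
    simp only [List.mem_map] at h1 h2
    obtain ⟨a, -, rfl⟩ := h1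
    obtain ⟨b, -, h⟩ := h2
    simp at h

theorem length_bitStrings (k : ℕ) : (bitStrings k).length = 2 ^ k := by
  induction k with
  | zero => simp [bitStrings]
  | succ k ih => simp [bitStrings, ih, pow_succ, mul_two]

theorem primrec_bitStrings : Primrec bitStrings := by
  have hmap (b : Bool) : Primrec fun p : ℕ × List (List Bool) => p.2.map (List.cons b) :=
    Primrec.list_map Primrec.snd (Primrec.list_cons.comp₂ (Primrec₂.const b) Primrec₂.right)
  refine (Primrec.nat_rec₁ [[]] (Primrec.list_append.comp (hmap false) (hmap true)).to₂).of_eq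
    fun k => ?_
  induction k with
  | zero => rfl
  | succ k ih => simp only [bitStrings, ← ih]

/-- A member of a computably enumerated finite family has complexity at most the logarithm of
the size of the family, up to a constant. -/
theorem IsUniversal.exists_complexity_le {U : Machine} (hU : IsUniversal U)
    {f : ℕ → List (List Bool)} (hf : Primrec f) :
    ∃ c : ℕ, ∀ (y k : ℕ) (x : List Bool), x ∈ f y → (f y).length ≤ 2 ^ k →
      complexity U x y ≤ k + c := by
  -- The length of the program fixes `k`, and its rank among the strings of that length is the index
  -- into `f y`. Hence `k` needs no encoding of its own and the overhead is constant.
  let g : List Bool × ℕ → Option (List Bool) := fun a =>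
    (f a.2)[(bitStrings a.1.length).idxOf a.1]?
  have hg : Primrec g := Primrec.list_getElem?.comp (hf.comp Primrec.snd)
    (primrec_idxOf.comp Primrec.fst
      (primrec_bitStrings.comp (Primrec.list_length.comp Primrec.fst)))
  obtain ⟨c, tr, htr⟩ := hU.2 (fun a => (g a : Part (List Bool))) (Computable.ofOption hg.to_comp)
  refine ⟨c, fun y k x hx hk => ?_⟩
  obtain ⟨i, hi, rfl⟩ := List.getElem_of_mem hx
  have hi' : i < (bitStrings k).length := by rw [length_bitStrings]; omega
  set p := (bitStrings k)[i] with hp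
  have hpl : p.length = k := mem_bitStrings.1 (List.getElem_mem hi')
  have hmem : (f y)[i] ∈ U (tr p, y) := by
    have : (bitStrings p.length).idxOf p = i := by
      rw [hpl, hp]; exact (nodup_bitStrings k).idxOf_getElem i hi'
    rw [(htr p).2 y]
    simp [g, this, hi]
  have hle : complexity U (f y)[i] y ≤ (tr p).length := Nat.sInf_le ⟨tr p, rfl, hmem⟩
  exact hle.trans (hpl ▸ (htr p).1)

/-! ### Hop tables -/

/-- The pairs `u < v < n` in lexicographical order. -/
def nodePairs (n : ℕ) : List (ℕ × ℕ) :=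
  (List.range n ×ˢ List.range n).filter fun e => e.1 < e.2

/-- The adjacency relation described by a graph code. -/
def codeAdj (n : ℕ) (c : List Bool) (a b : ℕ) : Bool :=
  c.getD ((nodePairs n).idxOf (min a b, max a b)) false

/-- The increasing list of the neighbours of `u`. -/
def nbrList (A : ℕ → ℕ → Bool) (n u : ℕ) : List ℕ :=
  (List.range n).filter fun w => A u w

/-- `0` for a neighbour `v` of `u`, otherwise one more than the position, among the neighbours of
`u`, of the first neighbour of `v`. -/
def hopIndex (A : ℕ → ℕ → Bool) (n u v : ℕ) : ℕ :=
  bif A u v then 0 else (nbrList A n u).findIdx (fun w => A w v) + 1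

/-- The hop indices at `u` of all destinations. -/
def hopTable (A : ℕ → ℕ → Bool) (n u : ℕ) : List ℕ :=
  (List.range n).map (hopIndex A n u)

/-- Self-delimiting unary code. -/
def unary (t : ℕ) : List Bool := List.replicate t true ++ [false]

/-- The bits stored at `u`. -/
def routingBits (A : ℕ → ℕ → Bool) (n u : ℕ) : List Bool :=
  (hopTable A n u).flatMap unary

/-- Some node has a long hop table, or some two nodes have no common neighbour. -/
def IsAtypical (A : ℕ → ℕ → Bool) (n : ℕ) : Prop :=
  ∃ u < n, 11 * n ≤ 4 * (routingBits A n u).length ∨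
    ∃ v < n, u ≠ v ∧ ∀ w < n, (A u w && A w v) = false

instance (A : ℕ → ℕ → Bool) (n : ℕ) : Decidable (IsAtypical A n) := by
  unfold IsAtypical; infer_instance

/-- The codes of the atypical graphs on `n` nodes. -/
def atypicalCodes (n : ℕ) : List (List Bool) :=
  (bitStrings (nodePairs n).length).filter fun c => IsAtypical (codeAdj n c) n

/-! ### Primitive recursiveness of the list of atypical codes -/

theorem primrec_nodePairs : Primrec nodePairs := by
  have h : Primrec fun n => List.range n ×ˢ List.range n :=
    Primrec.list_flatMap Primrec.list_range
      (Primrec.list_map (Primrec.list_range.comp Primrec.fst)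
        ((Primrec.pair (Primrec.snd.comp Primrec.fst) Primrec.snd).to₂)).to₂
  have hp : PrimrecPred fun e : ℕ × ℕ => e.1 < e.2 := Primrec.nat_lt
  exact (Primrec.listFilter hp).comp h

section

variable {α : Type*} [Primcodable α] {fn fu fv : α → ℕ} {fc : α → List Bool}

theorem primrec_codeAdj (hn : Primrec fn) (hc : Primrec fc) (hu : Primrec fu) (hv : Primrec fv) :
    Primrec fun a => codeAdj (fn a) (fc a) (fu a) (fv a) :=
  (Primrec.list_getD false).comp hc (primrec_idxOf.comp
    (Primrec.pair (Primrec.nat_min.comp hu hv) (Primrec.nat_max.comp hu hv))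
    (primrec_nodePairs.comp hn))

theorem primrec_nbrList (hn : Primrec fn) (hc : Primrec fc) (hu : Primrec fu) :
    Primrec fun a => nbrList (codeAdj (fn a) (fc a)) (fn a) (fu a) := by
  have h : PrimrecRel fun (w : ℕ) (x : (ℕ × List Bool) × ℕ) =>
      codeAdj x.1.1 x.1.2 x.2 w = true :=
    Primrec.eq.comp (primrec_codeAdj
      (Primrec.fst.comp (Primrec.fst.comp Primrec.snd))
      (Primrec.snd.comp (Primrec.fst.comp Primrec.snd))
      (Primrec.snd.comp Primrec.snd) Primrec.fst) (Primrec.const true)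
  refine (h.listFilter.comp (Primrec.list_range.comp hn)
    (Primrec.pair (Primrec.pair hn hc) hu)).of_eq fun a => ?_
  simp [nbrList]

theorem primrec_hopIndex (hn : Primrec fn) (hc : Primrec fc) (hu : Primrec fu)
    (hv : Primrec fv) :
    Primrec fun a => hopIndex (codeAdj (fn a) (fc a)) (fn a) (fu a) (fv a) :=
  Primrec.cond (primrec_codeAdj hn hc hu hv) (Primrec.const 0)
    (Primrec.succ.comp (Primrec.list_findIdx (primrec_nbrList hn hc hu)
      (primrec_codeAdj (hn.comp Primrec.fst) (hc.comp Primrec.fst) Primrec.snd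
        (hv.comp Primrec.fst)).to₂))

theorem primrec_unary : Primrec unary :=
  (Primrec.list_append.comp (Primrec.list_map Primrec.list_range (Primrec₂.const true))
    (Primrec.const [false])).of_eq fun t => by simp [unary]

theorem primrec_routingBits (hn : Primrec fn) (hc : Primrec fc) (hu : Primrec fu) :
    Primrec fun a => routingBits (codeAdj (fn a) (fc a)) (fn a) (fu a) :=
  Primrec.list_flatMap (Primrec.list_map (Primrec.list_range.comp hn)
    (primrec_hopIndex (hn.comp Primrec.fst) (hc.comp Primrec.fst) (hu.comp Primrec.fst)
      Primrec.snd).to₂) (primrec_unary.comp Primrec.snd).to₂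

end

theorem primrecRel_isAtypical :
    PrimrecRel fun (c : List Bool) (n : ℕ) => IsAtypical (codeAdj n c) n := by
  have hlong : PrimrecRel fun (u : ℕ) (x : List Bool × ℕ) =>
      11 * x.2 ≤ 4 * (routingBits (codeAdj x.2 x.1) x.2 u).length :=
    Primrec.nat_le.comp
      (Primrec.nat_mul.comp (Primrec.const 11) (Primrec.snd.comp Primrec.snd))
      (Primrec.nat_mul.comp (Primrec.const 4) (Primrec.list_length.comp
        (primrec_routingBits (Primrec.snd.comp Primrec.snd) (Primrec.fst.comp Primrec.snd)
          Primrec.fst)))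
  have hw : PrimrecRel fun (w : ℕ) (x : ℕ × ℕ × List Bool × ℕ) =>
      (codeAdj x.2.2.2 x.2.2.1 x.2.1 w && codeAdj x.2.2.2 x.2.2.1 w x.1) = false := by
    have hx : Primrec fun a : ℕ × ℕ × ℕ × List Bool × ℕ => a.2 := Primrec.snd
    have h2 := Primrec.snd.comp (Primrec.snd.comp hx)
    exact Primrec.eq.comp (Primrec.and.comp
      (primrec_codeAdj (Primrec.snd.comp h2) (Primrec.fst.comp h2)
        (Primrec.fst.comp (Primrec.snd.comp hx)) Primrec.fst)
      (primrec_codeAdj (Primrec.snd.comp h2) (Primrec.fst.comp h2)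
        Primrec.fst (Primrec.fst.comp hx))) (Primrec.const false)
  have hv : PrimrecRel fun (v : ℕ) (x : ℕ × List Bool × ℕ) =>
      x.1 ≠ v ∧ ∀ w < x.2.2,
        (codeAdj x.2.2 x.2.1 x.1 w && codeAdj x.2.2 x.2.1 w v) = false :=
    (Primrec.eq.comp (Primrec.fst.comp Primrec.snd) Primrec.fst).not.and
      ((primrecRel_forall_lt hw).comp (Primrec.snd.comp (Primrec.snd.comp Primrec.snd)) Primrec.id)
  have hu : PrimrecRel fun (u : ℕ) (x : List Bool × ℕ) =>
      11 * x.2 ≤ 4 * (routingBits (codeAdj x.2 x.1) x.2 u).length ∨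
        ∃ v < x.2, u ≠ v ∧ ∀ w < x.2, (codeAdj x.2 x.1 u w && codeAdj x.2 x.1 w v) = false :=
    hlong.or ((primrecRel_exists_lt hv).comp (Primrec.snd.comp Primrec.snd) Primrec.id)
  exact (primrecRel_exists_lt hu).comp Primrec.snd Primrec.id

theorem primrec_atypicalCodes : Primrec atypicalCodes :=
  primrecRel_isAtypical.listFilter.comp
    (primrec_bitStrings.comp (Primrec.list_length.comp primrec_nodePairs)) Primrec.id

/-! ### The decoder -/

/-- Inverse of the concatenation of unary codes. -/
def unaryDecode (l : List Bool) : List ℕ :=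
  l.foldr (fun b r => bif b then (r.headI + 1) :: r.tail else 0 :: r) []

/-- Read from the right, each `false` opens a new entry 0 and each `true` increments the entry
opened last. -/
theorem unaryDecode_flatMap (l : List ℕ) : unaryDecode (l.flatMap unary) = l := by
  have h1 (t : ℕ) (r : List Bool) : unaryDecode (unary t ++ r) = t :: unaryDecode r := by
    induction t with
    | zero => rfl
    | succ t ih =>
      have : unaryDecode (unary (t + 1) ++ r) =
          ((unaryDecode (unary t ++ r)).headI + 1) :: (unaryDecode (unary t ++ r)).tail := rfl
      rw [this, ih]; rfl
  induction l with
  | nil => rfl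
  | cons t l ih => rw [List.flatMap_cons, h1, ih]

/-- The position, among the edges at a node with hop table `T`, of the edge towards `v`. -/
def edgePosition (T : List ℕ) (v : ℕ) : ℕ :=
  if T.getD v 0 = 0 then ((T.take v).filter fun t => t = 0).length else T.getD v 0 - 1

/-- The decoder: the edge is found by its position. -/
def hopDecoder : Decoder := fun x =>
  x.2.2.1.getD (edgePosition (unaryDecode x.1) (x.2.2.2 - 1)) 0

theorem computable_hopDecoder : Computable hopDecoder := by
  have h0 : Primrec unaryDecode := by
    refine Primrec.list_foldr Primrec.id (Primrec.const []) (h := fun _ p =>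
      bif p.1 then (p.2.headI + 1) :: p.2.tail else 0 :: p.2) ?_
    have hr : Primrec fun a : List Bool × Bool × List ℕ => a.2.2 := Primrec.snd.comp Primrec.snd
    exact Primrec.cond (Primrec.fst.comp Primrec.snd)
      (Primrec.list_cons.comp (Primrec.succ.comp (Primrec.list_headI.comp hr))
        (Primrec.list_tail.comp hr))
      (Primrec.list_cons.comp (Primrec.const 0) hr)
  have h1 : Primrec₂ edgePosition := by
    have hg : Primrec fun p : List ℕ × ℕ => p.1.getD p.2 0 := Primrec.list_getD 0
    have hz : PrimrecPred fun t : ℕ => t = 0 := Primrec.eq.comp Primrec.id (Primrec.const 0)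
    exact Primrec.ite (Primrec.eq.comp hg (Primrec.const 0))
      (Primrec.list_length.comp ((Primrec.listFilter hz).comp
        (Primrec.list_take.comp Primrec.snd Primrec.fst)))
      (Primrec.pred.comp hg)
  have h3 : Primrec fun x : List Bool × ℕ × List ℕ × ℕ => x.2.2 := Primrec.snd.comp Primrec.snd
  exact ((Primrec.list_getD 0).comp (Primrec.fst.comp h3)
    (h1.comp (h0.comp Primrec.fst) (Primrec.pred.comp (Primrec.snd.comp h3)))).to_comp

/-! ### Averages over bit vectors -/

theorem dependsOn_bit {β : Type*} (i : β) (φ : Bool → ℝ) : DependsOn (fun e : β → Bool => φ (e i)) {i} :=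
  fun x y h => by simp [h i rfl]

theorem findIdx_congr {β : Type*} {L : List β} {p q : β → Bool} (h : ∀ i ∈ L, p i = q i) :
    L.findIdx p = L.findIdx q := by
  induction L with
  | nil => rfl
  | cons a L ih =>
    rw [List.findIdx_cons, List.findIdx_cons, h a (by simp), ih fun i hi => h i (by simp [hi])]

theorem dependsOn_findIdx {β : Type*} (L : List β) (φ : ℕ → ℝ) :
    DependsOn (fun e : β → Bool => φ (L.findIdx e)) {i | i ∈ L} :=
  fun _ _ h => congrArg φ (findIdx_congr h)

section Average

variable {β : Type*} [Fintype β] [DecidableEq β]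

/-- The average over all bit vectors. -/
noncomputable def average (f : (β → Bool) → ℝ) : ℝ := (∑ e, f e) / 2 ^ Fintype.card β

theorem average_const (c : ℝ) : average (fun _ : β → Bool => c) = c := by
  simp [average]

theorem average_add (f g : (β → Bool) → ℝ) :
    average (fun e => f e + g e) = average f + average g := by
  simp [average, Finset.sum_add_distrib, add_div]

theorem average_const_mul (c : ℝ) (f : (β → Bool) → ℝ) :
    average (fun e => c * f e) = c * average f := by
  simp [average, ← Finset.mul_sum, mul_div_assoc]

theorem average_sum {κ : Type*} (s : Finset κ) (f : κ → (β → Bool) → ℝ) :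
    average (fun e => ∑ i ∈ s, f i e) = ∑ i ∈ s, average (f i) := by
  simp only [average, ← Finset.sum_div]
  rw [Finset.sum_comm]

theorem average_mono {f g : (β → Bool) → ℝ} (h : ∀ e, f e ≤ g e) : average f ≤ average g := by
  unfold average
  gcongr
  exact h _

theorem average_nonneg {f : (β → Bool) → ℝ} (h : ∀ e, 0 ≤ f e) : 0 ≤ average f := by
  simpa [average_const] using average_mono (f := fun _ => 0) h

/-- Functions of disjoint sets of bits are independent. -/
theorem average_mul {f g : (β → Bool) → ℝ} {s t : Set β} (hf : DependsOn f s)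
    (hg : DependsOn g t) (hst : Disjoint s t) :
    average (fun e => f e * g e) = average f * average g := by
  classical
  -- Two vectors exchange their coordinates outside `s`. The first component then has the old `f`
  -- value and takes its `g` value from the second vector, which turns the product of two sums into
  -- a sum of products.
  let mix : (β → Bool) × (β → Bool) → (β → Bool) × (β → Bool) := fun p =>
    (fun i => if i ∈ s then p.1 i else p.2 i, fun i => if i ∈ s then p.2 i else p.1 i)
  have hmix : Function.Involutive mix := by
    rintro ⟨x, y⟩
    ext i <;> by_cases hi : i ∈ s <;> simp [mix, hi]
  have hsum : ∑ p : (β → Bool) × (β → Bool), f p.1 * g p.2 =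
      ∑ p : (β → Bool) × (β → Bool), f p.1 * g p.1 := by
    refine Fintype.sum_equiv hmix.toPerm _ _ fun p => ?_
    have h1 : f (mix p).1 = f p.1 := hf fun i hi => by simp [mix, hi]
    have h2 : g (mix p).1 = g p.2 := hg fun i hi => by
      simp [mix, Set.disjoint_right.1 hst hi]
    simp [h1, h2]
  rw [Fintype.sum_prod_type, Fintype.sum_prod_type] at hsum
  simp only [← Finset.mul_sum, ← Finset.sum_mul, Finset.sum_const, Finset.card_univ,
    Fintype.card_fun, Fintype.card_bool, nsmul_eq_mul, Nat.cast_pow, Nat.cast_ofNat] at hsum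
  unfold average
  rw [div_mul_div_comm, hsum, Finset.sum_congr rfl fun x _ => mul_left_comm _ _ _,
    ← Finset.mul_sum]
  field_simp

theorem average_prod {κ : Type*} (s : Finset κ) {f : κ → (β → Bool) → ℝ} {S : κ → Set β}
    (hf : ∀ i ∈ s, DependsOn (f i) (S i)) (hS : (s : Set κ).PairwiseDisjoint S) :
    average (fun e => ∏ i ∈ s, f i e) = ∏ i ∈ s, average (f i) := by
  classical
  induction s using Finset.induction_on with
  | empty => simp [average_const]
  | insert a s ha ih =>
    have hs : DependsOn (fun e => ∏ i ∈ s, f i e) (⋃ i ∈ s, S i) := fun x y hxy =>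
      Finset.prod_congr rfl fun i hi => hf i (Finset.mem_insert_of_mem hi) fun j hj =>
        hxy j (Set.mem_biUnion hi hj)
    simp only [Finset.prod_insert ha]
    rw [average_mul (hf a (Finset.mem_insert_self a s)) hs, ih
      (fun i hi => hf i (Finset.mem_insert_of_mem hi))
      (hS.subset (by simp))]
    rw [Set.disjoint_iUnion₂_right]
    intro i hi
    exact hS (by simp) (by simp [hi]) (by rintro rfl; exact ha hi)

/-- Flipping bit `i` permutes the vectors, so `φ (e i)` and `φ (!e i)` have the same average, while
their sum is constant. -/
theorem average_bit (i : β) (φ : Bool → ℝ) :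
    average (fun e => φ (e i)) = (φ false + φ true) / 2 := by
  have hflip : Function.Involutive fun e : β → Bool => Function.update e i (!e i) := by
    intro e; ext j; by_cases hj : j = i
    · subst hj; simp
    · simp [hj]
  have h1 : average (fun e : β → Bool => φ (e i)) = average fun e => φ (!e i) := by
    unfold average
    congr 1
    exact Fintype.sum_equiv hflip.toPerm _ _ fun e => by simp
  have h2 : average (fun e : β → Bool => φ (e i) + φ (!e i)) = φ false + φ true := by
    rw [← average_const (β := β) (φ false + φ true)]
    congr 1; funext e
    cases e i <;> simp [add_comm]
  rw [average_add, ← h1] at h2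
  linarith

/-- The exponential moment of the waiting time for the first `true`. -/
theorem average_pow_findIdx_le {L : List β} (hL : L.Nodup) :
    average (fun e => (4 / 3 : ℝ) ^ (L.findIdx e + 1)) ≤ 2 := by
  induction L with
  | nil => simp only [List.findIdx_nil]; rw [average_const]; norm_num
  | cons a L ih =>
    rw [List.nodup_cons] at hL
    -- Splitting on the first bit gives the recursion `x ↦ (2 / 3) * (1 + x)`, whose fixed point is
    -- 2; the empty list starts it at 4/3.
    let φ : Bool → ℝ := fun b => if b then 4 / 3 else 0
    let ψ : Bool → ℝ := fun b => if b then 0 else 4 / 3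
    have h (e : β → Bool) : (4 / 3 : ℝ) ^ ((a :: L).findIdx e + 1) =
        φ (e a) + ψ (e a) * (4 / 3 : ℝ) ^ (L.findIdx e + 1) := by
      rw [List.findIdx_cons]
      cases e a <;> simp [φ, ψ, pow_succ, mul_comm]
    simp only [h]
    rw [average_add, average_bit, average_mul (dependsOn_bit a ψ)
      (dependsOn_findIdx L fun k => (4 / 3 : ℝ) ^ (k + 1)) (by simpa using hL.1), average_bit]
    have := ih hL.2
    simp only [φ, ψ]
    norm_num
    linarith

/-- Markov's inequality, in counting form. -/
theorem card_filter_le_of_average_le (p : (β → Bool) → Prop) [DecidablePred p]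
    {f : (β → Bool) → ℝ} (hf : ∀ e, 0 ≤ f e) {a : ℝ} (ha : 0 < a) (hp : ∀ e, p e → a ≤ f e)
    {b : ℝ} (hb : average f ≤ b) :
    ((Finset.univ.filter p).card : ℝ) ≤ 2 ^ Fintype.card β * (b / a) := by
  have h1 : ((Finset.univ.filter p).card : ℝ) * a ≤ ∑ e, f e := by
    rw [← nsmul_eq_mul]
    refine (Finset.card_nsmul_le_sum _ _ _ fun e he => hp e (Finset.mem_filter.1 he).2).trans ?_
    exact Finset.sum_le_univ_sum_of_nonneg hf
  have h2 : ∑ e, f e ≤ 2 ^ Fintype.card β * b := by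
    unfold average at hb
    rw [div_le_iff₀ (by positivity)] at hb
    linarith
  rw [← mul_div_assoc, le_div_iff₀ ha]
  exact h1.trans h2

end Average

/-! ### Counting atypical graphs -/

theorem mem_nodePairs {n : ℕ} {e : ℕ × ℕ} : e ∈ nodePairs n ↔ e.1 < e.2 ∧ e.2 < n := by
  have h : e ∈ List.range n ×ˢ List.range n ↔ e.1 ∈ List.range n ∧ e.2 ∈ List.range n :=
    List.pair_mem_product
  simp only [nodePairs, List.mem_filter, decide_eq_true_eq, h, List.mem_range]
  omega

theorem nodup_nodePairs (n : ℕ) : (nodePairs n).Nodup :=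
  (List.nodup_range.product List.nodup_range).filter _

theorem codeAdj_comm (n : ℕ) (c : List Bool) (a b : ℕ) : codeAdj n c a b = codeAdj n c b a := by
  simp only [codeAdj, min_comm, max_comm]

/-- Makes edges into coordinates of the bit vector: distinct unordered pairs occupy distinct
coordinates, so independence of edges reduces to comparing pairs of nodes. The bound `2 ≤ n`
supplies a junk value for `ι` outside its domain. -/
theorem exists_pairIndex {n : ℕ} (hn : 2 ≤ n) :
    ∃ ι : ℕ → ℕ → Fin (nodePairs n).length,
      (∀ e a b, a < n → b < n → a ≠ b → codeAdj n (List.ofFn e) a b = e (ι a b)) ∧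
      ∀ a b c d, a < n → b < n → a ≠ b → c < n → d < n → c ≠ d → ι a b = ι c d →
        (a = c ∧ b = d) ∨ (a = d ∧ b = c) := by
  have hpos : 0 < (nodePairs n).length :=
    List.length_pos_of_mem (a := (0, 1)) (mem_nodePairs.2 ⟨by simp, hn⟩)
  have hmem {a b : ℕ} (ha : a < n) (hb : b < n) (hab : a ≠ b) :
      (min a b, max a b) ∈ nodePairs n := mem_nodePairs.2 ⟨by simp [hab.symm], by simp [ha, hb]⟩
  let ι : ℕ → ℕ → Fin (nodePairs n).length := fun a b =>
    if h : (nodePairs n).idxOf (min a b, max a b) < (nodePairs n).length then ⟨_, h⟩ else ⟨0, hpos⟩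
  have hι {a b : ℕ} (ha : a < n) (hb : b < n) (hab : a ≠ b) :
      ι a b = ⟨(nodePairs n).idxOf (min a b, max a b),
        List.idxOf_lt_length_iff.2 (hmem ha hb hab)⟩ :=
    dif_pos (List.idxOf_lt_length_iff.2 (hmem ha hb hab))
  refine ⟨ι, fun e a b ha hb hab => ?_, fun a b c d ha hb hab hc hd hcd h => ?_⟩
  · have hlt := List.idxOf_lt_length_iff.2 (hmem ha hb hab)
    rw [hι ha hb hab, codeAdj, List.getD_eq_getElem _ _ (by simpa using hlt), List.getElem_ofFn]
  · rw [hι ha hb hab, hι hc hd hcd, Fin.mk.injEq,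
      List.idxOf_inj (hmem ha hb hab)] at h
    simp only [Prod.mk.injEq] at h
    omega

theorem length_routingBits (A : ℕ → ℕ → Bool) (n u : ℕ) :
    (routingBits A n u).length = n + ∑ v ∈ Finset.range n, hopIndex A n u v := by
  have h (l : List ℕ) : (l.flatMap unary).length = l.length + l.sum := by
    induction l with
    | nil => rfl
    | cons t l ih => simp [List.flatMap_cons, unary, ih]; omega
  rw [routingBits, h, hopTable, List.length_map, List.length_range,
    ← List.sum_toFinset _ List.nodup_range, List.toFinset_range]

/-- A diagonal pair is not listed, so `idxOf` returns the length of the list and `getD` falls back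
to `false`; this needs `c` to have the right length. -/
theorem codeAdj_self {n : ℕ} {c : List Bool} (hc : c.length = (nodePairs n).length) (a : ℕ) :
    codeAdj n c a a = false := by
  have h : (a, a) ∉ nodePairs n := fun h => lt_irrefl a (mem_nodePairs.1 h).1
  rw [codeAdj, min_self, max_self, List.idxOf_eq_length h, ← hc, List.getD_eq_default _ _ le_rfl]

/-- By symmetry every neighbour of `u` is adjacent to `u`, so the search stops at position 0. -/
theorem hopIndex_self_le {A : ℕ → ℕ → Bool} (hA : ∀ a b, A a b = A b a) (n u : ℕ) :
    hopIndex A n u u ≤ 1 := by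
  unfold hopIndex
  cases A u u with
  | true => simp
  | false =>
    simp only [cond_false, add_le_iff_nonpos_left, nonpos_iff_eq_zero]
    rcases hl : nbrList A n u with _ | ⟨w, l⟩
    · rfl
    · have hw : w ∈ nbrList A n u := by simp [hl]
      rw [nbrList, List.mem_filter, hA] at hw
      rw [List.findIdx_cons, hw.2]
      rfl

/-- The entries for different `v` share the neighbourhood of `u`, but become independent once it is
fixed to be `R`: for `v ∉ R` the entry depends only on the edges between `R` and `v`. Each `v ∈ R`
then contributes 1/2, each other `v` at most `1 / 2 * 2 = 1`, and summing over `R` gives a factor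
3/2 per node. -/
theorem average_pow_hopIndex_le {n : ℕ} (hn : 2 ≤ n) {u : ℕ} (hu : u < n) :
    average (fun e : Fin (nodePairs n).length → Bool =>
      ∏ v ∈ Finset.range n, (4 / 3 : ℝ) ^ hopIndex (codeAdj n (List.ofFn e)) n u v) ≤
      (3 / 2) ^ n := by
  obtain ⟨ι, hadj, hinj⟩ := exists_pairIndex hn
  set s := (Finset.range n).erase u with hs
  have hsn {v : ℕ} (hv : v ∈ s) : v ≠ u ∧ v < n := by simpa [hs] using hv
  let L : Finset ℕ → ℕ → List (Fin (nodePairs n).length) := fun R v =>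
    ((List.range n).filter fun w => w ∈ R).map fun w => ι w v
  let φ : Bool → ℝ := fun b => if b then 1 else 0
  let ψ : Bool → ℝ := fun b => if b then 0 else 1
  let F : Finset ℕ → ℕ → (Fin (nodePairs n).length → Bool) → ℝ := fun R v e =>
    if v ∈ R then φ (e (ι u v)) else ψ (e (ι u v)) * (4 / 3 : ℝ) ^ ((L R v).findIdx e + 1)
  have hF0 (R v e) : 0 ≤ F R v e := by
    simp only [F, φ, ψ]
    split_ifs <;> positivity
  -- `F R v e` contains the indicator that `v` is on the correct side of `R`, so the true
  -- neighbourhood of `u` provides the term needed, and the others are nonnegative. The factor 4/3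
  -- pays for the entry of `u` itself.
  have hbound (e : Fin (nodePairs n).length → Bool) :
      ∏ v ∈ Finset.range n, (4 / 3 : ℝ) ^ hopIndex (codeAdj n (List.ofFn e)) n u v ≤
        4 / 3 * ∑ R ∈ s.powerset, ∏ v ∈ s, F R v e := by
    set A := codeAdj n (List.ofFn e) with hA
    let R := s.filter fun w => A u w
    have hnb : nbrList A n u = (List.range n).filter fun w => w ∈ R := by
      refine List.filter_congr fun w hw => ?_
      rw [List.mem_range] at hw
      by_cases hwu : w = u
      · simp [hwu, R, hs, hA, codeAdj_self (List.length_ofFn (f := e))]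
      · simp [R, hs, hw, hwu]
    have hR : R ∈ s.powerset := Finset.mem_powerset.2 (Finset.filter_subset _ _)
    rw [← Finset.mul_prod_erase _ _ (Finset.mem_range.2 hu)]
    have h1 : (4 / 3 : ℝ) ^ hopIndex A n u u ≤ 4 / 3 := by
      simpa using pow_le_pow_right₀ (by norm_num : (1 : ℝ) ≤ 4 / 3)
        (hopIndex_self_le (codeAdj_comm n _) n u)
    have h2 : ∏ v ∈ s, (4 / 3 : ℝ) ^ hopIndex A n u v = ∏ v ∈ s, F R v e := by
      refine Finset.prod_congr rfl fun v hv => ?_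
      obtain ⟨hvu, hvn⟩ := hsn hv
      have hA' : A u v = e (ι u v) := hadj e u v hu hvn hvu.symm
      cases hb : e (ι u v) with
      | true =>
        have hvR : v ∈ R := Finset.mem_filter.2 ⟨hv, by rw [hA', hb]⟩
        simp [F, hvR, hopIndex, hA', hb, φ]
      | false =>
        have hvR : v ∉ R := fun h => by
          have := (Finset.mem_filter.1 h).2
          rw [hA', hb] at this
          exact absurd this (by simp)
        have hidx : (nbrList A n u).findIdx (fun w => A w v) = (L R v).findIdx e := by
          rw [hnb]
          simp only [L, List.findIdx_map]
          refine findIdx_congr fun w hw => ?_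
          have hwR : w ∈ R := by simpa using (List.mem_filter.1 hw).2
          have hwv : w ≠ v := by rintro rfl; exact hvR hwR
          exact hadj e w v (hsn (Finset.mem_filter.1 hwR).1).2 hvn hwv
        simp [F, hvR, hopIndex, hA', hb, ψ, hidx]
    rw [← hs, h2]
    refine mul_le_mul h1 ?_ (Finset.prod_nonneg fun v _ => hF0 R v e) (by norm_num)
    exact Finset.single_le_sum (f := fun R => ∏ v ∈ s, F R v e)
      (fun R _ => Finset.prod_nonneg fun v _ => hF0 R v e) hR
  have hterm (R) (hR : R ∈ s.powerset) :
      average (fun e => ∏ v ∈ s, F R v e) ≤ ∏ v ∈ s, if v ∈ R then (1 / 2 : ℝ) else 1 := by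
    rw [Finset.mem_powerset] at hR
    have hLmem {v : ℕ} {i} (hi : i ∈ L R v) : ∃ w ∈ R, i = ι w v := by
      simp only [L, List.mem_map, List.mem_filter] at hi
      obtain ⟨w, hw, rfl⟩ := hi
      exact ⟨w, by simpa using hw.2, rfl⟩
    have hnot {v : ℕ} (hv : v ∈ s) (hvR : v ∉ R) : ι u v ∉ L R v := fun h => by
      obtain ⟨w, hw, hwv⟩ := hLmem h
      obtain ⟨hvu, hvn⟩ := hsn hv
      obtain ⟨hwu, hwn⟩ := hsn (hR hw)
      have hwv' : w ≠ v := by rintro rfl; exact hvR hw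
      have := hinj u v w v hu hvn hvu.symm hwn hvn hwv' hwv
      omega
    rw [average_prod s (S := fun v => {i | i = ι u v ∨ v ∉ R ∧ i ∈ L R v})]
    · refine Finset.prod_le_prod (fun v _ => average_nonneg fun e => hF0 R v e) fun v hv => ?_
      obtain ⟨hvu, hvn⟩ := hsn hv
      by_cases hvR : v ∈ R
      · simp only [F, hvR, if_true]
        rw [average_bit]
        norm_num [φ]
      · simp only [F, hvR, if_false]
        have hnd : (L R v).Nodup := by
          refine List.Nodup.map_on ?_ (List.nodup_range.filter _)
          intro a ha b hb hab
          have ha' : a ∈ R := by simpa using (List.mem_filter.1 ha).2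
          have hb' : b ∈ R := by simpa using (List.mem_filter.1 hb).2
          have hav : a ≠ v := by rintro rfl; exact hvR ha'
          have hbv : b ≠ v := by rintro rfl; exact hvR hb'
          have := hinj a v b v (hsn (hR ha')).2 hvn hav (hsn (hR hb')).2 hvn hbv hab
          omega
        rw [average_mul (dependsOn_bit _ ψ)
          (dependsOn_findIdx _ fun k => (4 / 3 : ℝ) ^ (k + 1))
          (by simpa using hnot hv hvR), average_bit]
        have := average_pow_findIdx_le hnd
        norm_num [ψ]
        linarith
    · intro v hv x y hxy
      have h1 : x (ι u v) = y (ι u v) := hxy _ (Or.inl rfl)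
      by_cases hvR : v ∈ R
      · simp only [F, hvR, if_true, h1]
      · simp only [F, hvR, if_false, h1]
        congr 1
        exact dependsOn_findIdx (L R v) (fun k => (4 / 3 : ℝ) ^ (k + 1))
          fun i hi => hxy i (Or.inr ⟨hvR, hi⟩)
    -- A pair `{w, v}` with `w ∈ R` and `v ∉ R` determines `v`, and a pair `{u, v}` is never of this
    -- kind because `u ∉ R`.
    · intro v hv v' hv' hne
      obtain ⟨hvu, hvn⟩ := hsn hv
      obtain ⟨hvu', hvn'⟩ := hsn hv'
      refine Set.disjoint_left.2 fun i hi hi' => ?_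
      rcases hi with rfl | ⟨hvR, hi⟩
      · rcases hi' with h | ⟨hvR', hi'⟩
        · have := hinj _ _ _ _ hu hvn hvu.symm hu hvn' hvu'.symm h
          omega
        · obtain ⟨w, hw, h⟩ := hLmem hi'
          obtain ⟨hwu, hwn⟩ := hsn (hR hw)
          have hwv : w ≠ v' := by rintro rfl; exact hvR' hw
          have := hinj _ _ _ _ hu hvn hvu.symm hwn hvn' hwv h
          omega
      · obtain ⟨w, hw, h⟩ := hLmem hi
        obtain ⟨hwu, hwn⟩ := hsn (hR hw)
        have hwv : w ≠ v := by rintro rfl; exact hvR hw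
        rcases hi' with rfl | ⟨hvR', hi'⟩
        · have := hinj _ _ _ _ hu hvn' hvu'.symm hwn hvn hwv h
          omega
        · obtain ⟨w', hw', rfl⟩ := hLmem hi'
          obtain ⟨hwu', hwn'⟩ := hsn (hR hw')
          have hwv' : w' ≠ v' := by rintro rfl; exact hvR' hw'
          rcases hinj _ _ _ _ hwn' hvn' hwv' hwn hvn hwv h with ⟨-, h⟩ | ⟨-, h⟩
          · exact hne h.symm
          · exact hvR' (h ▸ hw)
  calc _ ≤ average (fun e => 4 / 3 * ∑ R ∈ s.powerset, ∏ v ∈ s, F R v e) := average_mono hbound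
    _ = 4 / 3 * ∑ R ∈ s.powerset, average (fun e => ∏ v ∈ s, F R v e) := by
      rw [average_const_mul, average_sum]
    _ ≤ 4 / 3 * ∑ R ∈ s.powerset, ∏ v ∈ s, (if v ∈ R then (1 / 2 : ℝ) else 1) := by
      gcongr with R hR
      exact hterm R hR
    -- The sum over `R` is the expansion of this product. It has `n - 1` factors, and the missing
    -- factor 3/2 absorbs the 4/3.
    _ = 4 / 3 * ∏ v ∈ s, (1 / 2 + 1 : ℝ) := by
      rw [Finset.prod_add]
      congr 1
      refine Finset.sum_congr rfl fun R hR => ?_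
      rw [Finset.prod_ite, Finset.filter_mem_eq_inter, Finset.filter_notMem_eq_sdiff,
        Finset.inter_eq_right.2 (Finset.mem_powerset.1 hR)]
    _ ≤ (3 / 2) ^ n := by
      rw [Finset.prod_const, hs, Finset.card_erase_of_mem (Finset.mem_range.2 hu),
        Finset.card_range]
      obtain ⟨m, rfl⟩ : ∃ m, n = m + 1 := ⟨n - 1, by omega⟩
      have : (0 : ℝ) < (3 / 2) ^ m := by positivity
      norm_num [pow_succ]
      linarith

/-- Each of the `n - 2` other nodes `w` fails to be a common neighbour with probability 3/4,
independently, since the pairs `{u, w}` and `{w, v}` are all distinct. -/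
theorem average_noCommonNeighbour_le {n : ℕ} (hn : 2 ≤ n) {u v : ℕ} (hu : u < n) (hv : v < n)
    (huv : u ≠ v) :
    average (fun e : Fin (nodePairs n).length → Bool =>
      if ∀ w < n, (codeAdj n (List.ofFn e) u w && codeAdj n (List.ofFn e) w v) = false
        then 1 else 0) ≤ (3 / 4 : ℝ) ^ (n - 2) := by
  obtain ⟨ι, hadj, hinj⟩ := exists_pairIndex hn
  set s := ((Finset.range n).erase u).erase v with hs
  have hsn {w : ℕ} (hw : w ∈ s) : w ≠ v ∧ w ≠ u ∧ w < n := by simpa [hs] using hw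
  let φ : Bool → ℝ := fun b => if b then 1 else 0
  let F : ℕ → (Fin (nodePairs n).length → Bool) → ℝ := fun w e =>
    1 + (-1) * (φ (e (ι u w)) * φ (e (ι w v)))
  have hF0 (w e) : 0 ≤ F w e := by
    simp only [F, φ]
    split_ifs <;> norm_num
  have hcard : s.card = n - 2 := by
    rw [hs, Finset.card_erase_of_mem (by simp [hv, huv.symm]),
      Finset.card_erase_of_mem (by simp [hu]), Finset.card_range]
    omega
  calc _ ≤ average (fun e => ∏ w ∈ s, F w e) := by
        refine average_mono fun e => ?_
        split_ifs with h
        · refine (Finset.prod_eq_one fun w hw => ?_).ge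
          obtain ⟨hwv, hwu, hwn⟩ := hsn hw
          have := h w hwn
          rw [hadj e u w hu hwn hwu.symm, hadj e w v hwn hv hwv, Bool.and_eq_false_iff] at this
          rcases this with h | h <;> simp [F, φ, h]
        · exact Finset.prod_nonneg fun w _ => hF0 w e
    _ = ∏ w ∈ s, average (F w) := by
        refine average_prod s (S := fun w => {ι u w, ι w v}) ?_ ?_
        · intro w hw x y hxy
          simp only [F, hxy (ι u w) (by simp), hxy (ι w v) (by simp)]
        · intro w hw w' hw' hne
          obtain ⟨hwv, hwu, hwn⟩ := hsn hw
          obtain ⟨hwv', hwu', hwn'⟩ := hsn hw'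
          refine Set.disjoint_left.2 fun i hi hi' => ?_
          simp only [Set.mem_insert_iff, Set.mem_singleton_iff] at hi hi'
          rcases hi with rfl | rfl <;> rcases hi' with h | h
          · have := hinj _ _ _ _ hu hwn hwu.symm hu hwn' hwu'.symm h
            omega
          · have := hinj _ _ _ _ hu hwn hwu.symm hwn' hv hwv' h
            omega
          · have := hinj _ _ _ _ hwn hv hwv hu hwn' hwu'.symm h
            omega
          · have := hinj _ _ _ _ hwn hv hwv hwn' hv hwv' h
            omega
    _ ≤ ∏ w ∈ s, (3 / 4 : ℝ) := by
        refine Finset.prod_le_prod (fun w _ => average_nonneg fun e => hF0 w e) fun w hw => ?_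
        obtain ⟨hwv, hwu, hwn⟩ := hsn hw
        have hne : ι u w ≠ ι w v := fun h => by
          have := hinj _ _ _ _ hu hwn hwu.symm hwn hv hwv h
          omega
        simp only [F]
        rw [average_add, average_const, average_const_mul,
          average_mul (dependsOn_bit _ φ) (dependsOn_bit _ φ) (by simpa using hne),
          average_bit, average_bit]
        norm_num [φ]
    _ = (3 / 4 : ℝ) ^ (n - 2) := by rw [Finset.prod_const, hcard]

/-- Atypical graphs are exponentially rare. -/
theorem length_atypicalCodes_le {n : ℕ} (hn : 2 ≤ n) :
    ((atypicalCodes n).length : ℝ) ≤ 2 ^ (nodePairs n).length *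
      (n * ((3 / 2) ^ n / (4 / 3) ^ (7 * (n / 4))) + n * (n * (3 / 4) ^ (n - 2))) := by
  set N := (nodePairs n).length with hN
  let A : (Fin N → Bool) → ℕ → ℕ → Bool := fun e => codeAdj n (List.ofFn e)
  let long : ℕ → Finset (Fin N → Bool) := fun u =>
    Finset.univ.filter fun e => 11 * n ≤ 4 * (routingBits (A e) n u).length
  let far : ℕ → ℕ → Finset (Fin N → Bool) := fun u v =>
    Finset.univ.filter fun e => u ≠ v ∧ ∀ w < n, (A e u w && A e w v) = false
  have hlong (u : ℕ) (hu : u < n) :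
      ((long u).card : ℝ) ≤ 2 ^ N * ((3 / 2) ^ n / (4 / 3) ^ (7 * (n / 4))) := by
    have := card_filter_le_of_average_le
      (fun e : Fin N → Bool => 11 * n ≤ 4 * (routingBits (A e) n u).length)
      (fun e => Finset.prod_nonneg fun v _ => by positivity) (a := (4 / 3) ^ (7 * (n / 4)))
      (by positivity) (fun e he => ?_) (average_pow_hopIndex_le hn hu)
    · simpa using this
    · rw [Finset.prod_pow_eq_pow_sum]
      refine pow_le_pow_right₀ (by norm_num) ?_
      -- The `n` terminating bits account for `4 * n` of `11 * n`, so the entries sum to at least `7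
      -- * n / 4`.
      rw [length_routingBits] at he
      simp only [A] at he
      omega
  have hfar (u v : ℕ) (hu : u < n) (hv : v < n) :
      ((far u v).card : ℝ) ≤ 2 ^ N * (3 / 4) ^ (n - 2) := by
    by_cases huv : u = v
    · simp only [far, huv, ne_eq, not_true, false_and, Finset.filter_false, Finset.card_empty,
        Nat.cast_zero]
      positivity
    · have := card_filter_le_of_average_le
        (fun e : Fin N → Bool => u ≠ v ∧ ∀ w < n, (A e u w && A e w v) = false)
        (fun e => by split_ifs <;> norm_num) (a := 1) one_pos (fun e he => ?_)
        (average_noCommonNeighbour_le hn hu hv huv)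
      · simpa only [div_one, Fintype.card_fin] using this
      · exact (if_pos he.2).ge
  have hsub : (atypicalCodes n).toFinset ⊆
      ((Finset.range n).biUnion long ∪
        (Finset.range n).biUnion fun u => (Finset.range n).biUnion (far u)).image List.ofFn := by
    intro c hc
    rw [List.mem_toFinset, atypicalCodes, List.mem_filter, mem_bitStrings] at hc
    obtain ⟨hlen, hat⟩ := hc
    obtain ⟨e, rfl⟩ : ∃ e : Fin N → Bool, List.ofFn e = c :=
      ⟨fun i => c.get (i.cast (hN.trans hlen.symm)), by apply List.ext_getElem <;> simp [hlen, hN]⟩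
    refine Finset.mem_image_of_mem _ ?_
    obtain ⟨u, hu, h | ⟨v, hv, h⟩⟩ := of_decide_eq_true hat
    · refine Finset.mem_union_left _ (Finset.mem_biUnion.2 ⟨u, by simpa using hu, ?_⟩)
      exact Finset.mem_filter.2 ⟨Finset.mem_univ _, h⟩
    · refine Finset.mem_union_right _ (Finset.mem_biUnion.2 ⟨u, by simpa using hu,
        Finset.mem_biUnion.2 ⟨v, by simpa using hv, ?_⟩⟩)
      exact Finset.mem_filter.2 ⟨Finset.mem_univ _, h⟩
  have hcard : (atypicalCodes n).length ≤ ∑ u ∈ Finset.range n, (long u).card +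
      ∑ u ∈ Finset.range n, ∑ v ∈ Finset.range n, (far u v).card := by
    have hnd : (atypicalCodes n).Nodup := (nodup_bitStrings _).filter _
    rw [← List.toFinset_card_of_nodup hnd]
    refine (Finset.card_le_card hsub).trans (Finset.card_image_le.trans
      ((Finset.card_union_le _ _).trans (add_le_add Finset.card_biUnion_le ?_)))
    exact Finset.card_biUnion_le.trans (Finset.sum_le_sum fun u _ => Finset.card_biUnion_le)
  calc ((atypicalCodes n).length : ℝ) ≤ ∑ u ∈ Finset.range n, ((long u).card : ℝ) +
      ∑ u ∈ Finset.range n, ∑ v ∈ Finset.range n, ((far u v).card : ℝ) := by exact_mod_cast hcard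
    _ ≤ ∑ u ∈ Finset.range n, (2 : ℝ) ^ N * ((3 / 2) ^ n / (4 / 3) ^ (7 * (n / 4))) +
      ∑ u ∈ Finset.range n, ∑ v ∈ Finset.range n, (2 : ℝ) ^ N * (3 / 4) ^ (n - 2) := by
      gcongr with u hu u hu v hv
      · exact hlong u (Finset.mem_range.1 hu)
      · exact hfar u v (Finset.mem_range.1 hu) (Finset.mem_range.1 hv)
    _ = _ := by
      simp only [Finset.sum_const, Finset.card_range, nsmul_eq_mul]
      ring

/-! ### The routing scheme of a typical graph -/

/-! ### Graph codes and adjacency -/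

section GraphCode

variable {n : ℕ} (G : SimpleGraph (Fin n))

theorem nodePairs_eq_map (n : ℕ) : nodePairs n =
    ((List.finRange n ×ˢ List.finRange n).filter fun e => e.1 < e.2).map
      (Prod.map Fin.val Fin.val) := by
  have h : List.range n ×ˢ List.range n =
      (List.finRange n ×ˢ List.finRange n).map (Prod.map Fin.val Fin.val) := by
    rw [← List.map_coe_finRange_eq_range]
    simp only [SProd.sprod, List.product, List.map_flatMap, List.flatMap_map, List.map_map]
    rfl
  rw [nodePairs, h, List.filter_map]
  rfl

theorem length_graphCode : (graphCode G).length = (nodePairs n).length := by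
  simp [graphCode, nodePairs_eq_map]

theorem codeAdj_graphCode (a b : Fin n) : codeAdj n (graphCode G) a b = true ↔ G.Adj a b := by
  classical
  have key (a b : Fin n) (hab : a < b) :
      codeAdj n (graphCode G) a b = true ↔ G.Adj a b := by
    set l := (List.finRange n ×ˢ List.finRange n).filter fun e => e.1 < e.2 with hl
    have hmem : (a, b) ∈ l := by
      have : (a, b) ∈ List.finRange n ×ˢ List.finRange n :=
        List.pair_mem_product.2 ⟨List.mem_finRange a, List.mem_finRange b⟩
      simp [hl, this, hab]
    have hidx : (nodePairs n).idxOf ((a : ℕ), (b : ℕ)) = l.idxOf (a, b) := by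
      rw [nodePairs_eq_map, ← hl, List.idxOf, List.idxOf, List.findIdx_map]
      refine findIdx_congr fun e _ => ?_
      rw [Bool.eq_iff_iff]
      simp [Prod.ext_iff, Fin.ext_iff]
    have hlt := List.idxOf_lt_length_iff.2 hmem
    have hab' : (a : ℕ) ≤ b := hab.le
    rw [codeAdj, min_eq_left hab', max_eq_right hab', hidx, graphCode, ← hl,
      List.getD_eq_getElem _ _ (by simpa using hlt), List.getElem_map, List.getElem_idxOf]
    simp
  rcases lt_trichotomy a b with h | rfl | h
  · exact key a b h
  · simp [codeAdj_self (length_graphCode G)]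
  · rw [codeAdj_comm, key b a h, G.adj_comm]

end GraphCode

/-! ### Positions of edges in the neighbour list -/

section Positions

variable {A : ℕ → ℕ → Bool} {n u v w : ℕ}

theorem mem_nbrList : w ∈ nbrList A n u ↔ w < n ∧ A u w = true := by
  simp [nbrList]

theorem pairwise_nbrList : (nbrList A n u).Pairwise (· < ·) :=
  List.pairwise_lt_range.filter _

theorem hopTable_getD (hv : v < n) : (hopTable A n u).getD v 0 = hopIndex A n u v := by
  rw [List.getD_eq_getElem _ _ (by simpa [hopTable] using hv)]
  simp [hopTable]

theorem hopIndex_eq_zero : hopIndex A n u v = 0 ↔ A u v = true := by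
  unfold hopIndex
  cases A u v <;> simp

/-- The zeros of the table mark exactly the neighbours of `u`, so the number of zeros before `v` is
the rank of `v` among them. -/
theorem getElem?_edgePosition_of_adj (hv : v < n) (huv : A u v = true) :
    (nbrList A n u)[edgePosition (hopTable A n u) v]? = some v := by
  have hpos : edgePosition (hopTable A n u) v = ((List.range v).filter fun w => A u w).length := by
    rw [edgePosition, hopTable_getD hv, if_pos (hopIndex_eq_zero.2 huv), hopTable, ← List.map_take,
      List.take_range, min_eq_left hv.le, List.filter_map, List.length_map]
    congr 2
    funext w
    rw [Bool.eq_iff_iff]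
    simp [hopIndex_eq_zero]
  have hnb : nbrList A n u = ((List.range v).filter fun w => A u w) ++
      v :: (((List.range (n - v - 1)).map fun i => v + (i + 1)).filter fun w => A u w) := by
    obtain ⟨k, rfl⟩ : ∃ k, n = v + (k + 1) := ⟨n - v - 1, by omega⟩
    have hk : v + (k + 1) - v - 1 = k := by omega
    rw [nbrList, List.range_add, List.filter_append, List.range_succ_eq_map, List.map_cons,
      List.filter_cons_of_pos (by simpa using huv), hk, List.map_map]
    rfl
  rw [hpos, hnb, List.getElem?_append_right le_rfl]
  simp

/-- The nonzero entry is the position shifted by one; a common neighbour guarantees that the search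
did not run off the list. -/
theorem getElem?_edgePosition_of_not_adj (hv : v < n) (huv : A u v = false)
    (hw : ∃ w < n, (A u w && A w v) = true) :
    ∃ w < n, A u w = true ∧ A w v = true ∧
      (nbrList A n u)[edgePosition (hopTable A n u) v]? = some w := by
  have hpos : edgePosition (hopTable A n u) v =
      (nbrList A n u).findIdx fun w => A w v := by
    rw [edgePosition, hopTable_getD hv, if_neg (by rw [hopIndex_eq_zero]; simp [huv]), hopIndex,
      huv]
    rfl
  have hlt : (nbrList A n u).findIdx (fun w => A w v) < (nbrList A n u).length := by
    obtain ⟨w, hwn, hw⟩ := hw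
    rw [Bool.and_eq_true] at hw
    exact List.findIdx_lt_length.2 ⟨w, mem_nbrList.2 ⟨hwn, hw.1⟩, hw.2⟩
  have hm := mem_nbrList.1 (List.getElem_mem hlt)
  refine ⟨_, hm.1, hm.2, List.findIdx_getElem (w := hlt), ?_⟩
  rw [hpos, List.getElem?_eq_getElem hlt]

theorem idxOf_lt_idxOf {l : List ℕ} (hl : l.Pairwise (· < ·)) {a b : ℕ} (ha : a ∈ l)
    (hb : b ∈ l) (hab : a < b) : l.idxOf a < l.idxOf b := by
  have ha' := List.idxOf_lt_length_iff.2 ha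
  have hb' := List.idxOf_lt_length_iff.2 hb
  by_contra! h
  rcases h.eq_or_lt with h | h
  · exact hab.ne' ((List.idxOf_inj hb).1 h)
  · have := List.pairwise_iff_getElem.1 hl _ _ hb' ha' h
    simp only [List.getElem_idxOf] at this
    omega

/-- The label at `u` of the edge to `w`: its position in the free port model, otherwise the
label of `w`. -/
def edgeName (A : ℕ → ℕ → Bool) (n : ℕ) : EdgeModel → ℕ → ℕ → ℕ
  | .freePorts, u, w => (nbrList A n u).idxOf w + 1
  | .neighboursKnown, _, w => w + 1

/-- Monotonicity makes the sorted list of edge labels follow the neighbour list, so a rank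
identifies an edge in either edge model. -/
theorem edgeName_lt_edgeName (E : EdgeModel) {a b : ℕ} (ha : a ∈ nbrList A n u)
    (hb : b ∈ nbrList A n u) (hab : a < b) : edgeName A n E u a < edgeName A n E u b := by
  cases E with
  | freePorts => exact Nat.succ_lt_succ (idxOf_lt_idxOf pairwise_nbrList ha hb hab)
  | neighboursKnown => exact Nat.succ_lt_succ hab

theorem edgeName_injOn (E : EdgeModel) :
    Set.InjOn (edgeName A n E u) {w | w ∈ nbrList A n u} := by
  intro a ha b hb hab
  rcases lt_trichotomy a b with h | h | h
  · exact absurd hab (edgeName_lt_edgeName E ha hb h).ne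
  · exact h
  · exact absurd hab (edgeName_lt_edgeName E hb ha h).ne'

end Positions

/-! ### Correctness and cost of the scheme -/

section Scheme

variable {n : ℕ} (G : SimpleGraph (Fin n))

theorem mem_nbrList_graphCode {u w : Fin n} :
    (w : ℕ) ∈ nbrList (codeAdj n (graphCode G)) n u ↔ G.Adj u w := by
  rw [mem_nbrList, codeAdj_graphCode]
  simp

/-- The routing scheme in which every node stores its hop table. -/
noncomputable def hopScheme (E : EdgeModel) : RoutingScheme G where
  label u := u + 1
  label_injective _ _ h := Fin.ext (Nat.succ_injective h)
  edgeLabel u w := edgeName (codeAdj n (graphCode G)) n E u w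
  edgeLabel_injOn _ _ ha _ hb h := Fin.ext (edgeName_injOn E
    ((mem_nbrList_graphCode G).2 ha) ((mem_nbrList_graphCode G).2 hb) h)
  bits u := routingBits (codeAdj n (graphCode G)) n u

theorem hopScheme_labelsConform (E : EdgeModel) (L : LabelModel) :
    (hopScheme G E).LabelsConform L := by
  cases L with
  | fixed => exact fun u => rfl
  | permuted => exact fun u => ⟨Nat.succ_pos _, u.2⟩
  | free => trivial

theorem hopScheme_edgesConform (E : EdgeModel) : (hopScheme G E).EdgesConform E := by
  cases E with
  | neighboursKnown => exact fun u w _ => rfl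
  | freePorts =>
    intro u
    set l := nbrList (codeAdj n (graphCode G)) n u with hl
    have hnd : l.Nodup := pairwise_nbrList.imp fun h => h.ne
    have himg : Fin.val '' G.neighborSet u = (l.toFinset : Set ℕ) := by
      ext w
      simp only [Set.mem_image, SimpleGraph.mem_neighborSet, List.coe_toFinset, Set.mem_ofPred_eq]
      constructor
      · rintro ⟨w, hw, rfl⟩
        exact (mem_nbrList_graphCode G).2 hw
      · intro hw
        exact ⟨⟨w, (mem_nbrList.1 hw).1⟩, (mem_nbrList_graphCode G).1 hw, rfl⟩
    have hcard : (G.neighborSet u).ncard = l.length := by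
      rw [← Set.ncard_image_of_injective _ Fin.val_injective, himg, Set.ncard_coe_finset,
        List.toFinset_card_of_nodup hnd]
    refine ⟨fun w hw => ?_, (hopScheme G .freePorts).edgeLabel_injOn u, fun i hi => ?_⟩
    · rw [hcard]
      exact ⟨Nat.succ_pos _, List.idxOf_lt_length_iff.2 ((mem_nbrList_graphCode G).2 hw)⟩
    · rw [hcard] at hi
      have hlt : i - 1 < l.length := by have := hi.1; have := hi.2; omega
      have hmem : l[i - 1] ∈ l := List.getElem_mem hlt
      refine ⟨⟨l[i - 1], (mem_nbrList.1 hmem).1⟩, (mem_nbrList_graphCode G).1 hmem, ?_⟩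
      have : l.idxOf l[i - 1] = i - 1 := hnd.idxOf_getElem _ hlt
      have := hi.1
      change l.idxOf l[i - 1] + 1 = i
      omega

theorem incidentLabels_hopScheme (E : EdgeModel) (u : Fin n) :
    (hopScheme G E).incidentLabels u =
      (nbrList (codeAdj n (graphCode G)) n u).map (edgeName (codeAdj n (graphCode G)) n E u) := by
  classical
  set l := nbrList (codeAdj n (graphCode G)) n u with hl
  set l' := l.map (edgeName (codeAdj n (graphCode G)) n E u) with hl'
  have hpw : l'.Pairwise (· < ·) := by
    rw [hl', List.pairwise_map]
    exact pairwise_nbrList.imp_of_mem fun ha hb => edgeName_lt_edgeName E ha hb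
  have hset : (Finset.univ.filter fun w => G.Adj u w).image ((hopScheme G E).edgeLabel u) =
      l'.toFinset := by
    ext x
    simp only [Finset.mem_image, Finset.mem_filter, Finset.mem_univ, true_and, List.mem_toFinset,
      hl', List.mem_map]
    constructor
    · rintro ⟨w, hw, rfl⟩
      exact ⟨w, (mem_nbrList_graphCode G).2 hw, rfl⟩
    · rintro ⟨w, hw, rfl⟩
      exact ⟨⟨w, (mem_nbrList.1 hw).1⟩, (mem_nbrList_graphCode G).1 hw, rfl⟩
  rw [RoutingScheme.incidentLabels, ← (List.toFinset_sort (· ≤ ·) (hpw.imp fun h => h.ne)).2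
    (hpw.imp fun h => h.le)]
  convert rfl using 2
  rw [← hset]

theorem route_hopScheme (E : EdgeModel) {u v w : Fin n}
    (h : (nbrList (codeAdj n (graphCode G)) n u)[
      edgePosition (hopTable (codeAdj n (graphCode G)) n u) v]? = some (w : ℕ)) :
    (hopScheme G E).route hopDecoder u v = (hopScheme G E).edgeLabel u w := by
  rw [RoutingScheme.route, hopDecoder, incidentLabels_hopScheme]
  -- The destination label is `v + 1`, and the decoder subtracts 1.
  change List.getD _ (edgePosition (unaryDecode (routingBits _ _ _)) (v : ℕ)) 0 = _
  rw [routingBits, unaryDecode_flatMap, List.getD_eq_getElem?_getD, List.getElem?_map, h]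
  rfl

/-- Common neighbours make every distance at most 2. A neighbour is reached directly; otherwise the
stored hop leads to a neighbour of the destination. -/
theorem hopScheme_isShortestPath (E : EdgeModel)
    (hG : ∀ u v : Fin n, u ≠ v → ∃ w, G.Adj u w ∧ G.Adj w v) :
    (hopScheme G E).IsShortestPath hopDecoder := by
  have hone {u v : Fin n} (h : G.Adj u v) : (hopScheme G E).Delivers hopDecoder 1 u v :=
    .hop h.ne h (route_hopScheme G E (getElem?_edgePosition_of_adj v.2
      ((codeAdj_graphCode G u v).2 h))) (.arrived v)
  intro u v
  by_cases huv : u = v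
  · subst huv
    rw [SimpleGraph.dist_self]
    exact .arrived u
  by_cases hadj : G.Adj u v
  · rw [SimpleGraph.dist_eq_one_iff_adj.2 hadj]
    exact hone hadj
  obtain ⟨x, hux, hxv⟩ := hG u v huv
  obtain ⟨w, hwn, huw, hwv, hpos⟩ := getElem?_edgePosition_of_not_adj
    (A := codeAdj n (graphCode G)) (u := u) v.2
    (by rw [← Bool.not_eq_true, codeAdj_graphCode]; exact hadj)
    ⟨x, x.2, by
      rw [Bool.and_eq_true, codeAdj_graphCode, codeAdj_graphCode]; exact ⟨hux, hxv⟩⟩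
  lift w to Fin n using hwn
  rw [codeAdj_graphCode] at huw hwv
  have hdist : G.dist u v = 2 := by
    have hle : G.dist u v ≤ 2 :=
      SimpleGraph.dist_le (SimpleGraph.Walk.cons huw (SimpleGraph.Walk.cons hwv .nil))
    have h0 : G.dist u v ≠ 0 := fun h => huv
      (((huw.reachable.trans hwv.reachable).dist_eq_zero_iff).1 h)
    have h1 : G.dist u v ≠ 1 := fun h => hadj (SimpleGraph.dist_eq_one_iff_adj.1 h)
    omega
  rw [hdist]
  exact .hop huv huw (route_hopScheme G E hpos) (hone hwv)

theorem nodeCost_hopScheme_le (E : EdgeModel) (L : LabelModel) (u : Fin n)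
    (hsize : 4 * n.size ≤ n)
    (hbits : 4 * (routingBits (codeAdj n (graphCode G)) n u).length < 11 * n) :
    (hopScheme G E).nodeCost L u ≤ 3 * n := by
  have h1 : ((hopScheme G E).bits u).length =
    (routingBits (codeAdj n (graphCode G)) n u).length := rfl
  have h2 : Nat.size ((hopScheme G E).label u) ≤ n.size := Nat.size_le_size u.2
  cases L <;> simp only [RoutingScheme.nodeCost, h1] <;> omega

theorem exists_scheme_of_not_isAtypical (E : EdgeModel) (L : LabelModel)
    (hsize : 4 * n.size ≤ n) (hG : ¬ IsAtypical (codeAdj n (graphCode G)) n) :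
    ∃ S : RoutingScheme G, S.EdgesConform E ∧ S.LabelsConform L ∧ S.IsShortestPath hopDecoder ∧
      (∀ u, S.nodeCost L u ≤ 3 * n) ∧ ∑ u, S.nodeCost L u ≤ 3 * n ^ 2 := by
  simp only [IsAtypical, not_exists, not_and, not_or, not_le] at hG
  have hcost (u : Fin n) : (hopScheme G E).nodeCost L u ≤ 3 * n :=
    nodeCost_hopScheme_le G E L u hsize (hG u u.2).1
  refine ⟨hopScheme G E, hopScheme_edgesConform G E, hopScheme_labelsConform G E L,
    hopScheme_isShortestPath G E fun u v huv => ?_, hcost, ?_⟩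
  · have h := (hG u u.2).2 v v.2 (fun h => huv (Fin.ext h))
    simp only [not_forall] at h
    obtain ⟨w, hwn, hw⟩ := h
    lift w to Fin n using hwn
    rw [Bool.not_eq_false, Bool.and_eq_true, codeAdj_graphCode, codeAdj_graphCode] at hw
    exact ⟨w, hw⟩
  · calc ∑ u, (hopScheme G E).nodeCost L u ≤ ∑ _u : Fin n, 3 * n :=
        Finset.sum_le_sum fun u _ => hcost u
      _ = 3 * n ^ 2 := by simp; ring

end Scheme

/-! ### Random graphs are typical -/

theorem length_nodePairs (n : ℕ) : ((nodePairs n).length : ℝ) = (n : ℝ) * ((n : ℝ) - 1) / 2 := by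
  have hcard : (nodePairs n).length = ∑ b ∈ Finset.range n, b := by
    rw [← List.toFinset_card_of_nodup (nodup_nodePairs n),
      Finset.card_eq_sum_card_fiberwise (f := Prod.snd) (t := Finset.range n)]
    · refine Finset.sum_congr rfl fun b hb => ?_
      have : (nodePairs n).toFinset.filter (fun e => e.2 = b) =
          (Finset.range b).image fun a => (a, b) := by
        ext ⟨x, y⟩
        have := Finset.mem_range.1 hb
        simp only [Finset.mem_filter, List.mem_toFinset, mem_nodePairs, Finset.mem_image,
          Finset.mem_range, Prod.mk.injEq]
        constructor
        · rintro ⟨⟨h1, h2⟩, rfl⟩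
          exact ⟨x, h1, rfl, rfl⟩
        · rintro ⟨a, ha, rfl, rfl⟩
          exact ⟨⟨ha, this⟩, rfl⟩
      rw [this, Finset.card_image_of_injective _ fun a b h => (Prod.mk.inj h).1,
        Finset.card_range]
    · intro e he
      simp only [List.coe_toFinset, Set.mem_ofPred_eq, mem_nodePairs] at he
      simpa using he.2
  rw [hcard, Nat.cast_sum]
  clear hcard
  induction n with
  | zero => simp
  | succ n ih =>
    rw [Finset.sum_range_succ, ih]
    push_cast
    ring

/-! ### Numerical estimates and the complexity argument -/

theorem eventually_six_mul_sq_le : ∀ᶠ n : ℕ in Filter.atTop, 6 * n ^ 2 ≤ 2 ^ (n / 16) := by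
  have h1 := tendsto_pow_const_mul_const_pow_of_abs_lt_one 2
    (show |(1 / 2 : ℝ)| < 1 by rw [abs_of_pos] <;> norm_num)
  -- With `h = n / 16 ≥ 1` one has `n ≤ 32 * h`, and `6144 = 6 * 32 ^ 2`.
  have h2 := (h1.eventually (ge_mem_nhds (show (0 : ℝ) < 1 / 6144 by norm_num))).and
    (Filter.eventually_ge_atTop 1)
  have h3 : Filter.Tendsto (fun n : ℕ => n / 16) Filter.atTop Filter.atTop :=
    Nat.tendsto_div_const_atTop (by norm_num)
  filter_upwards [h3.eventually h2] with n hn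
  obtain ⟨hn, hpos⟩ := hn
  set h := n / 16 with hh
  have hlt : n ≤ 32 * h := by omega
  have h4 : (6144 : ℝ) * h ^ 2 ≤ 2 ^ h := by
    rw [one_div, inv_pow, ← div_eq_mul_inv, div_le_iff₀ (by positivity)] at hn
    linarith
  have h5 : 6144 * h ^ 2 ≤ 2 ^ h := by exact_mod_cast h4
  calc 6 * n ^ 2 ≤ 6 * (32 * h) ^ 2 := by gcongr
    _ = 6144 * h ^ 2 := by ring
    _ ≤ 2 ^ h := h5

/-- Per block of four nodes both failure rates are below 7/10, since `(81 / 16) / (4 / 3) ^ 7` and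
`(3 / 4) ^ 4` are. As `(7 / 10) ^ 4 ≤ 1 / 4`, the decay is `(1 / 2) ^ (n / 16)` squared, and one
factor absorbs the polynomial `6 * n ^ 2`. -/
theorem atypical_ratio_le {n : ℕ} (hn : 1 ≤ n) (h : 6 * n ^ 2 ≤ 2 ^ (n / 16)) :
    (n : ℝ) * ((3 / 2) ^ n / (4 / 3) ^ (7 * (n / 4))) + n * (n * (3 / 4) ^ (n - 2)) ≤
      (1 / 2) ^ (n / 16) := by
  set q := n / 4 with hq
  have h1 : (3 / 2 : ℝ) ^ n / (4 / 3) ^ (7 * q) ≤ 4 * (7 / 10) ^ q := by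
    have e1 : (3 / 2 : ℝ) ^ n ≤ 4 * (81 / 16) ^ q := by
      calc (3 / 2 : ℝ) ^ n ≤ (3 / 2) ^ (4 * q + 3) :=
            pow_le_pow_right₀ (by norm_num) (by omega)
        _ = 27 / 8 * (81 / 16) ^ q := by rw [pow_add, pow_mul]; norm_num; ring
        _ ≤ 4 * (81 / 16) ^ q := by gcongr; norm_num
    rw [div_le_iff₀ (by positivity)]
    refine e1.trans ?_
    rw [pow_mul, mul_assoc, ← mul_pow]
    gcongr
    norm_num
  have h2 : (3 / 4 : ℝ) ^ (n - 2) ≤ 2 * (7 / 10) ^ q := by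
    calc (3 / 4 : ℝ) ^ (n - 2) = 16 / 9 * ((3 / 4) ^ (n - 2) * (3 / 4) ^ 2) := by ring
      _ ≤ 2 * ((3 / 4) ^ (4 * q)) := by
        rw [← pow_add]
        gcongr ?_ * ?_
        · norm_num
        · exact pow_le_pow_of_le_one (by norm_num) (by norm_num) (by omega)
      _ ≤ 2 * (7 / 10) ^ q := by
        rw [pow_mul]
        gcongr
        norm_num
  have h3 : (7 / 10 : ℝ) ^ q ≤ (1 / 2) ^ (n / 16) * (1 / 2) ^ (n / 16) := by
    calc (7 / 10 : ℝ) ^ q ≤ (7 / 10) ^ (4 * (n / 16)) :=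
          pow_le_pow_of_le_one (by norm_num) (by norm_num) (by omega)
      _ ≤ (1 / 4) ^ (n / 16) := by
        rw [pow_mul]
        gcongr
        norm_num
      _ = _ := by rw [← mul_pow]; norm_num
  have h4 : 6 * (n : ℝ) ^ 2 * (1 / 2) ^ (n / 16) ≤ 1 := by
    rw [one_div, inv_pow, ← div_eq_mul_inv, div_le_one (by positivity)]
    exact_mod_cast h
  have hn' : (n : ℝ) ≤ n ^ 2 := by
    have : (1 : ℝ) ≤ n := by exact_mod_cast hn
    nlinarith
  calc (n : ℝ) * ((3 / 2) ^ n / (4 / 3) ^ (7 * q)) + n * (n * (3 / 4) ^ (n - 2))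
      ≤ n ^ 2 * (4 * (7 / 10) ^ q) + n * (n * (2 * (7 / 10) ^ q)) := by gcongr
    _ = 6 * n ^ 2 * (7 / 10) ^ q := by ring
    _ ≤ 6 * n ^ 2 * ((1 / 2) ^ (n / 16) * (1 / 2) ^ (n / 16)) := by gcongr
    _ = (6 * n ^ 2 * (1 / 2) ^ (n / 16)) * (1 / 2) ^ (n / 16) := by ring
    _ ≤ 1 * (1 / 2) ^ (n / 16) := by gcongr
    _ = _ := one_mul _

theorem eventually_isRandomGraph_not_isAtypical {U : Machine} (hU : IsUniversal U) {δ : ℕ → ℝ}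
    (hδ : δ =O[Filter.atTop] fun n : ℕ => Real.logb 2 (n : ℝ)) :
    ∀ᶠ n : ℕ in Filter.atTop, ∀ G : SimpleGraph (Fin n), IsRandomGraph U δ G →
      ¬ IsAtypical (codeAdj n (graphCode G)) n := by
  -- The enumeration uses only `n` from the condition and ignores the part coding `δ n`, so `c` does
  -- not depend on `n`.
  obtain ⟨c, hc⟩ := hU.exists_complexity_le
    (primrec_atypicalCodes.comp (Primrec.fst.comp Primrec.unpair))
  have hlog : (fun n : ℕ => Real.logb 2 (n : ℝ)) =o[Filter.atTop] fun n : ℕ => (n : ℝ) := by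
    simp only [Real.logb, div_eq_inv_mul]
    exact (Real.isLittleO_log_id_atTop.comp_tendsto
      tendsto_natCast_atTop_atTop).const_mul_left _
  have hsmall := (hδ.trans_isLittleO hlog).def (show (0 : ℝ) < 1 / 32 by norm_num)
  filter_upwards [hsmall, eventually_six_mul_sq_le, Filter.eventually_gt_atTop (32 * (c + 1))]
    with n hδn hpow hn G hG hat
  have hNn := length_nodePairs n
  set N := (nodePairs n).length with hN
  have hnN : n / 16 ≤ N := by
    have : (n : ℝ) ≤ N := by
      have : (32 : ℝ) < n := by exact_mod_cast (show 32 < n by omega)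
      nlinarith
    have : n ≤ N := by exact_mod_cast this
    omega
  have hlen : (atypicalCodes n).length ≤ 2 ^ (N - n / 16) := by
    have h1 := (length_atypicalCodes_le (n := n) (by omega)).trans
      (mul_le_mul_of_nonneg_left (atypical_ratio_le (by omega) hpow) (by positivity))
    have h2 : (2 : ℝ) ^ N * (1 / 2) ^ (n / 16) = 2 ^ (N - n / 16) := by
      rw [one_div, inv_pow, ← div_eq_mul_inv, pow_sub₀ _ two_ne_zero hnN, div_eq_mul_inv]
    rw [← hN, h2] at h1
    exact_mod_cast h1
  have hmem : graphCode G ∈ atypicalCodes n := by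
    rw [atypicalCodes, List.mem_filter, mem_bitStrings]
    exact ⟨length_graphCode G, by simpa using hat⟩
  have hle := hc (Nat.pair n ⌊δ n⌋₊) (N - n / 16) (graphCode G)
    (by simpa using hmem) (by simpa using hlen)
  have hle' : (complexity U (graphCode G) (Nat.pair n ⌊δ n⌋₊) : ℝ) ≤
      N - (n / 16 : ℕ) + c := by
    rw [← Nat.cast_sub hnN]
    exact_mod_cast hle
  unfold IsRandomGraph at hG
  rw [← hNn] at hG
  have h16 : (n : ℝ) ≤ 16 * (n / 16 : ℕ) + 16 := by
    exact_mod_cast (show n ≤ 16 * (n / 16) + 16 by omega)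
  have hn' : (32 : ℝ) * (c + 1) < n := by exact_mod_cast hn
  have hδ' : δ n ≤ 1 / 32 * n := by
    refine (le_abs_self _).trans ?_
    simpa using hδn
  -- The description has at most `N - n / 16 + 1 + c` bits (real division), and `1 + c < n / 32`, so
  -- it is shorter than `N - n / 32 ≤ N - δ n`.
  linarith

end CompactRouting

theorem mainTheorem1 (E : CompactRouting.EdgeModel) (L : CompactRouting.LabelModel) :
    ∃ D : CompactRouting.Decoder, Computable D ∧
      ∀ U : CompactRouting.Machine, CompactRouting.IsUniversal U →
      ∀ δ : ℕ → ℝ, (δ =O[Filter.atTop] fun n : ℕ => Real.logb 2 (n : ℝ)) →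
      ∀ᶠ n : ℕ in Filter.atTop, ∀ G : SimpleGraph (Fin n),
        CompactRouting.IsRandomGraph U δ G →
        ∃ S : CompactRouting.RoutingScheme G,
          S.EdgesConform E ∧ S.LabelsConform L ∧ S.IsShortestPath D ∧
          (∀ u, S.nodeCost L u ≤ 3 * n) ∧ ∑ u, S.nodeCost L u ≤ 3 * n ^ 2 := by
  refine ⟨CompactRouting.hopDecoder, CompactRouting.computable_hopDecoder, fun U hU δ hδ => ?_⟩
  filter_upwards [CompactRouting.eventually_isRandomGraph_not_isAtypical hU hδ,
    CompactRouting.eventually_six_mul_sq_le, Filter.eventually_ge_atTop 1] with n hn hpow hpos G hG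
  refine CompactRouting.exists_scheme_of_not_isAtypical G E L ?_ (hn G hG)
  -- This makes the binary length of a label at most `n / 4`, the room left above the table.
  have h1 : n < 2 ^ (n / 4) := by
    have h2 : 2 ^ (n / 16) ≤ 2 ^ (n / 4) := Nat.pow_le_pow_right (by norm_num) (by omega)
    nlinarith
  have := Nat.size_le.2 h1
  omega
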